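/- Let $\mathcal H_A,\mathcal H_B$ be complex Hilbert spaces (of arbitrary dimension), and let $\mathcal H_A\otimes\mathcal H_B$ be their Hilbert-space tensor product. A one-way LOCC binary discrimination protocol (from Alice to Bob) with $n$ bits of communication consists of a measurement of Alice with a discrete set $I$ of outcomes, given by positive operators $(E^{(i)})_{i\in I}$ on $\mathcal H_A$ with $\sum_i E^{(i)}=\mathds 1$; a map $i\mapsto m(i)\in\{0,1\}^n$, the message sent to Bob; and, for each $m\in\{0,1\}^n$, a two-outcome measurement $(F^{(m)},\mathds 1-F^{(m)})$ of Bob, with $0\le F^{(m)}\le\mathds 1$ on $\mathcal H_B$. Bob guesses the first state on outcome $F^{(m)}$ and the second state otherwise, so that the protocol is described by the operator $M=\sum_i E^{(i)}\otimes F^{(m(i))}$, $0\le M\le \mathds 1$ (sums converge strongly). For $\tau\in\mathcal H_A\otimes\mathcal H_B$ and $a\in\mathcal H_A$ write $\tau^{|a}:=(\langle a|\otimes\mathds 1)\tau\in\mathcal H_B$. For every pair of orthogonal unit vectors $\psi,\phi\in\mathcal H_A\otimes\mathcal H_B$ and every $\varepsilon>0$ there is a one-way LOCC binary discrimination protocol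 with a finite number $n$ of bits of communication (depending on $\psi,\phi,\varepsilon$) that distinguishes the two states with success probability at least $1-\varepsilon$ on each of them: $\langle\psi|M|\psi\rangle\ge 1-\varepsilon$ and $\langle\phi|(\mathds 1-M)|\phi\rangle\ge 1-\varepsilon$. Moreover, the protocol can be chosen as follows. Alice measures in an orthonormal basis $\mathcal E$ of $\mathcal H_A$, that is, $E^{(e)}=|e\rangle\langle e|$ for $e\in\mathcal E$, such that $\langle\phi^{|e}|\psi^{|e}\rangle=0$ for all $e\in\mathcal E$. There is a finite nonempty set $G\subseteq\mathcal E$ such that $\langle\psi|\big(\sum_{e\in G}|e\rangle\langle e|\otimes\mathds 1\big)|\psi\rangle$ and $\langle\phi|\big(\sum_{e\in G}|e\rangle\langle e|\otimes\mathds 1\big)|\phi\rangle$ are both at least $1-\varepsilon$. Alice's message specifies her outcome when it lies in $G$, and is one fixed other string when it does not; it has $n\le\lceil\log_2|G|\rceil+1$ bits. On every outcome $e\in G$ Bob discriminates the conditional states perfectly: $F^{(m(e))}\psi^{|e}=\psi^{|e}$ and $F^{(m(e))}\phi^{|e}=0$. -/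

import Mathlib

open scoped TensorProduct

noncomputable section

section Bipartite

variable (HA HB : Type*)
  [NormedAddCommGroup HA] [InnerProductSpace ℂ HA]
  [NormedAddCommGroup HB] [InnerProductSpace ℂ HB]

/-- The Hilbert-space tensor product of two complex Hilbert spaces: the completion of the
algebraic tensor product for the inner product
`⟪a ⊗ b, c ⊗ d⟫ = ⟪a, c⟫ * ⟪b, d⟫`. -/
abbrev HilbertTensor : Type _ := UniformSpace.Completion (HA ⊗[ℂ] HB)

variable {HA HB}

/-- The product vector `|v⟩ ⊗ |w⟩` in the Hilbert-space tensor product. -/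
def productVector (v : HA) (w : HB) : HilbertTensor HA HB :=
  ((v ⊗ₜ[ℂ] w : HA ⊗[ℂ] HB) : UniformSpace.Completion (HA ⊗[ℂ] HB))

/-- The bounded operator `E ⊗ F` on the Hilbert-space tensor product, as the continuous
extension of `v ⊗ w ↦ E v ⊗ F w`. -/
def operatorTensor (E : HA →L[ℂ] HA) (F : HB →L[ℂ] HB) :
    HilbertTensor HA HB →L[ℂ] HilbertTensor HA HB :=
  ((UniformSpace.Completion.toComplL (𝕜 := ℂ) (E := HA ⊗[ℂ] HB)) ∘L
      TensorProduct.mapL E F).extend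
    (UniformSpace.Completion.toComplL (𝕜 := ℂ) (E := HA ⊗[ℂ] HB))

theorem operatorTensor_productVector (E : HA →L[ℂ] HA) (F : HB →L[ℂ] HB) (v : HA) (w : HB) :
    operatorTensor E F (productVector v w) = productVector (E v) (F w) :=
  ContinuousLinearMap.extend_eq _
    (UniformSpace.Completion.denseRange_coe (α := HA ⊗[ℂ] HB))
    (UniformSpace.Completion.isUniformInducing_coe (HA ⊗[ℂ] HB)) (v ⊗ₜ[ℂ] w)

variable [CompleteSpace HB]

/-- The bounded operator `⟨a| ⊗ 1` from the Hilbert-space tensor product to `HB`, as the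
continuous extension of `v ⊗ w ↦ ⟪a, v⟫ • w`. -/
def partialBra (a : HA) : HilbertTensor HA HB →L[ℂ] HB :=
  (((TensorProduct.lidIsometry ℂ HB).toContinuousLinearEquiv : (ℂ ⊗[ℂ] HB) →L[ℂ] HB) ∘L
      (innerSL ℂ a).rTensor HB).extend
    (UniformSpace.Completion.toComplL (𝕜 := ℂ) (E := HA ⊗[ℂ] HB))

/-- The (unnormalised) state of system `B` conditioned on the outcome `a` on system `A`. -/
def condState (τ : HilbertTensor HA HB) (a : HA) : HB := partialBra a τ

theorem condState_productVector (v : HA) (w : HB) (a : HA) :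
    condState (productVector v w) a = inner ℂ a v • w :=
  (ContinuousLinearMap.extend_eq _
    (UniformSpace.Completion.denseRange_coe (α := HA ⊗[ℂ] HB))
    (UniformSpace.Completion.isUniformInducing_coe (HA ⊗[ℂ] HB)) (v ⊗ₜ[ℂ] w)).trans
    (TensorProduct.lid_tmul _ _)

end Bipartite

/-- The Born rule in a pure state: for a unit vector `τ` and an effect `0 ≤ M ≤ 1`, the number
`Tr (M |τ⟩⟨τ|) = ⟨τ| M |τ⟩` is the probability of the outcome `M`. -/
def bornProb {H : Type*} [NormedAddCommGroup H] [InnerProductSpace ℂ H]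
    (M : H →L[ℂ] H) (τ : H) : ℝ :=
  (inner ℂ τ (M τ)).re

/-- A one-way LOCC binary discrimination protocol from Alice to Bob with `n` bits of classical
communication. Alice performs a measurement with a discrete set `I` of outcomes, described by
positive operators `E i` that resolve the identity (strongly). On outcome `i` she sends the
`n`-bit string `message i`. On receiving the string `m`, Bob performs the two-outcome
measurement `(F m, 1 - F m)`; he guesses the first state on the outcome `F m`, and the
second state on the outcome `1 - F m`. -/
structure OneWayLOCC (HA HB : Type*)
    [NormedAddCommGroup HA] [InnerProductSpace ℂ HA] [CompleteSpace HA]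
    [NormedAddCommGroup HB] [InnerProductSpace ℂ HB] [CompleteSpace HB]
    (I : Type*) (n : ℕ) where
  /-- Alice's measurement operators. -/
  E : I → HA →L[ℂ] HA
  E_pos : ∀ i, (E i).IsPositive
  E_sum : ∀ x, HasSum (fun i => E i x) x
  /-- The string of `n` bits that Alice sends. -/
  message : I → (Fin n → Bool)
  /-- Bob's effect for the first guess, depending only on the received string. -/
  F : (Fin n → Bool) → HB →L[ℂ] HB
  F_pos : ∀ m, (F m).IsPositive
  F_le_one : ∀ m, (1 - F m).IsPositive

/-- `M` is the operator `∑ i, E i ⊗ F (message i)` of the protocol (strongly convergent sum):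
the effect on the composite system for the event that Bob guesses the first state. -/
def OneWayLOCC.HasOperator {HA HB : Type*}
    [NormedAddCommGroup HA] [InnerProductSpace ℂ HA] [CompleteSpace HA]
    [NormedAddCommGroup HB] [InnerProductSpace ℂ HB] [CompleteSpace HB]
    {I : Type*} {n : ℕ} (P : OneWayLOCC HA HB I n)
    (M : HilbertTensor HA HB →L[ℂ] HilbertTensor HA HB) : Prop :=
  ∀ x, HasSum (fun i => operatorTensor (P.E i) (P.F (P.message i)) x) (M x)

end

/-! The form `s a c = ⟨φ^{|c}|ψ^{|a}⟩` on `HA` has diagonal sum `⟨φ|ψ⟩ = 0` in every Hilbert basis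
(`HilbertBasis.hasSum_inner_condState`). Such a form has zero diagonal in some basis
(`exists_hilbertBasis_zero_diagonal`): take a maximal orthonormal set `S` of isotropic vectors and
extend it to a basis. The values of `s x x` on `Sᗮ` form a convex cone in the plane
(`sesq_add_mem`). A nonzero diagonal entry would give a nontrivial series in this cone with sum
zero, so the cone, closed or not, contains two opposite nonzero values, and combining the vectors
attaining them gives an isotropic vector in `Sᗮ`, against maximality. In that basis Bob's
conditional states are orthogonal, so projecting onto `ψ^{|e}` separates them exactly. Finitely many
outcomes carry all but `ε` of both norms; on the others Bob always guesses `φ`. -/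

/-! ### Planar cones and phases. -/

/-- A convex cone in the plane that contains the terms of a nontrivial series with sum zero
contains a nonzero vector together with its opposite. -/
theorem exists_neg_mem_of_hasSum_zero {ι : Type*} {C : Set ℂ} (h0 : (0 : ℂ) ∈ C)
    (hadd : ∀ a ∈ C, ∀ b ∈ C, a + b ∈ C) (hsmul : ∀ r : ℝ, 0 ≤ r → ∀ a ∈ C, r • a ∈ C)
    {z : ι → ℂ} (hz : ∀ i, z i ∈ C) (hs : HasSum z 0) {j : ι} (hj : z j ≠ 0) :
    ∃ a ∈ C, a ≠ 0 ∧ -a ∈ C := by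
  by_contra! hC
  have hconv : Convex ℝ C := fun a ha b hb r t hr ht _ =>
    hadd _ (hsmul r hr a ha) _ (hsmul t ht b hb)
  -- A supporting functional at 0: either 0 is a non-interior point of a cone with interior, or the
  -- cone spans a proper real subspace.
  obtain ⟨f, hf, hfC⟩ : ∃ f : ℂ →L[ℝ] ℝ, f ≠ 0 ∧ ∀ a ∈ C, f a ≤ 0 := by
    by_cases hint : (interior C).Nonempty
    · have h0i : (0 : ℂ) ∉ interior C := by
        intro h
        obtain ⟨δ, hδ, hball⟩ := Metric.mem_nhds_iff.1 (mem_interior_iff_mem_nhds.1 h)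
        have hmem : ∀ a : ℂ, ‖a‖ < δ → a ∈ C := fun a ha => hball (by simpa using ha)
        have hn : ‖((δ / 2 : ℝ) : ℂ)‖ < δ := by
          rw [Complex.norm_real, Real.norm_eq_abs, abs_of_pos (by positivity)]; linarith
        refine hC ((δ / 2 : ℝ) : ℂ) (hmem _ hn) ?_ (hmem _ (by rwa [norm_neg]))
        exact_mod_cast (by positivity : δ / 2 ≠ 0)
      obtain ⟨f, hf, h⟩ := geometric_hahn_banach_of_nonempty_interior_point hconv h0i hint
      exact ⟨f, hf, by simpa using h⟩
    · rw [hconv.interior_nonempty_iff_affineSpan_eq_top] at hint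
      have hlt : Submodule.span ℝ C < ⊤ := by
        rw [lt_top_iff_ne_top]
        intro h
        apply hint
        rw [← Set.insert_eq_of_mem h0]
        exact SetLike.coe_injective (by rw [affineSpan_insert_zero, h]; simp)
      obtain ⟨f, hf, h⟩ := Submodule.exists_le_ker_of_lt_top _ hlt
      refine ⟨LinearMap.toContinuousLinearMap f, fun h' => hf ?_, fun a ha => ?_⟩
      · ext1 x; exact congrArg (fun g : ℂ →L[ℝ] ℝ => g x) h'
      · exact (LinearMap.mem_ker.1 (h (Submodule.subset_span ha))).le
  have hfz : ∀ i, f (z i) = 0 := by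
    have h1 : HasSum (fun i => -f (z i)) 0 := by simpa using (f.hasSum hs).neg
    have h2 := (hasSum_zero_iff_of_nonneg (fun i => neg_nonneg.2 (hfC _ (hz i)))).1 h1
    intro i
    simpa using congrFun h2 i
  have hfe : ∀ w : ℂ, f w = w.re * f 1 + w.im * f Complex.I := by
    intro w
    have : w = w.re • (1 : ℂ) + w.im • Complex.I := by
      simp [Complex.re_add_im]
    conv_lhs => rw [this]
    simp only [map_add, map_smul, smul_eq_mul]
  -- The kernel of `f ≠ 0` is a line, so it is the real line through `z j`.
  have hreal : ∀ w, f w = 0 → (w / z j).im = 0 := by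
    intro w hw
    have hj0 := hfz j
    rw [hfe] at hw hj0
    have hdet : w.im * (z j).re - w.re * (z j).im = 0 := by
      by_contra hd
      apply hf
      have h1 : f 1 = 0 := by
        apply (mul_eq_zero.1 (?_ : (w.im * (z j).re - w.re * (z j).im) * f 1 = 0)).resolve_left hd
        linear_combination w.im * hj0 - (z j).im * hw
      have hI : f Complex.I = 0 := by
        apply (mul_eq_zero.1
          (?_ : (w.im * (z j).re - w.re * (z j).im) * f Complex.I = 0)).resolve_left hd
        linear_combination (z j).re * hw - w.re * hj0
      ext1 x
      rw [hfe x, h1, hI]; simp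
    rw [Complex.div_im, div_sub_div_same, hdet, zero_div]
  have hmul : ∀ i, z i = (z i / z j).re • z j := by
    intro i
    have : ((z i / z j).re : ℂ) = z i / z j :=
      Complex.ext (by simp) (by simp [hreal _ (hfz i)])
    rw [Complex.real_smul, this, div_mul_cancel₀ _ hj]
  have hnn : ∀ i, 0 ≤ (z i / z j).re := by
    intro i
    by_contra! hneg
    refine hC (z i) (hz i) ?_ ?_
    · intro h; simp [h] at hneg
    · rw [hmul i, ← neg_smul]
      exact hsmul _ (by linarith) _ (hz j)
  have hsum : HasSum (fun i => (z i / z j).re) 0 := by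
    simpa using Complex.hasSum_re (hs.div_const (z j))
  have := congrFun ((hasSum_zero_iff_of_nonneg hnn).1 hsum) j
  simp [hj] at this

/-- Cross terms can be rotated onto a prescribed ray. -/
theorem exists_phase (u w p : ℂ) (hp : p ≠ 0) :
    ∃ (θ : ℂ) (r : ℝ), ‖θ‖ = 1 ∧ 0 ≤ r ∧ θ * u + starRingEnd ℂ θ * w = r * p := by
  obtain ⟨θ, hθ, him⟩ : ∃ θ : ℂ, ‖θ‖ = 1 ∧
      (θ * (u / p) + starRingEnd ℂ θ * (w / p)).im = 0 := by
    -- The imaginary part in question equals that of `θ * d`, so it suffices to rotate `d` onto the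
    -- real axis.
    set d := u / p - starRingEnd ℂ (w / p) with hd
    obtain ⟨θ, hθ, h⟩ : ∃ θ : ℂ, ‖θ‖ = 1 ∧ (θ * d).im = 0 := by
      by_cases h : d = 0
      · exact ⟨1, by simp, by simp [h]⟩
      · refine ⟨‖d‖ / d, by simp [h], ?_⟩
        rw [div_mul_cancel₀ _ h, Complex.ofReal_im]
    refine ⟨θ, hθ, ?_⟩
    rw [← h, hd]
    simp only [Complex.add_im, Complex.mul_im, Complex.sub_im, Complex.sub_re, Complex.conj_re,
      Complex.conj_im]
    ring
  set c := θ * (u / p) + starRingEnd ℂ θ * (w / p) with hc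
  have hcr : (c.re : ℂ) = c := Complex.ext (by simp) (by simp [him])
  have hcp : θ * u + starRingEnd ℂ θ * w = c.re * p := by
    rw [hcr, hc]; field_simp
  rcases le_total 0 c.re with h | h
  · exact ⟨θ, c.re, hθ, h, hcp⟩
  · refine ⟨-θ, -c.re, by simpa using hθ, by linarith, ?_⟩
    simp only [map_neg, Complex.ofReal_neg]
    linear_combination -hcp

/-! ### Diagonal values of a sesquilinear form. -/

section Form

variable {E : Type*} [AddCommGroup E] [Module ℂ E] (s : E →ₗ⋆[ℂ] E →ₗ[ℂ] ℂ)

theorem sesq_add_smul (x y : E) (θ : ℂ) :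
    s (x + θ • y) (x + θ • y) =
      s x x + (θ * s x y + starRingEnd ℂ θ * s y x) + (starRingEnd ℂ θ * θ) * s y y := by
  simp only [map_add, LinearMap.add_apply, LinearMap.map_smulₛₗ, LinearMap.smul_apply,
    smul_eq_mul, RingHom.id_apply]
  ring

theorem sesq_real_smul (x : E) (r : ℝ) :
    s ((r : ℂ) • x) ((r : ℂ) • x) = (r ^ 2 : ℝ) • s x x := by
  simp only [LinearMap.map_smulₛₗ, LinearMap.smul_apply, smul_eq_mul, RingHom.id_apply,
    Complex.real_smul, Complex.conj_ofReal]
  push_cast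
  ring

theorem norm_eq_one_conj_mul {θ : ℂ} (h : ‖θ‖ = 1) : starRingEnd ℂ θ * θ = 1 := by
  rw [Complex.conj_mul', h]; simp

theorem sesq_smul_mem (K : Submodule ℂ E) (r : ℝ) (hr : 0 ≤ r) {a : ℂ}
    (ha : ∃ x ∈ K, s x x = a) : ∃ x ∈ K, s x x = r • a := by
  obtain ⟨x, hx, rfl⟩ := ha
  exact ⟨((√r : ℝ) : ℂ) • x, K.smul_mem _ hx, by rw [sesq_real_smul, Real.sq_sqrt hr]⟩

/-- A conclusion of Toeplitz–Hausdorff type: the values of a sesquilinear form on the diagonal of a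
subspace are closed under addition. -/
theorem sesq_add_mem (K : Submodule ℂ E) {a b : ℂ}
    (ha : ∃ x ∈ K, s x x = a) (hb : ∃ x ∈ K, s x x = b) : ∃ x ∈ K, s x x = a + b := by
  by_cases hp : a + b = 0
  · exact ⟨0, K.zero_mem, by simp [hp]⟩
  obtain ⟨x, hx, rfl⟩ := ha
  obtain ⟨y, hy, rfl⟩ := hb
  -- With the cross terms on the ray of `a + b`, the value at `x + θ • y` is `(1 + r)(a + b)`;
  -- rescaling finishes.
  obtain ⟨θ, r, hθ, hr, h⟩ := exists_phase (s x y) (s y x) _ hp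
  have hz : s (x + θ • y) (x + θ • y) = (1 + r : ℝ) • (s x x + s y y) := by
    rw [sesq_add_smul, h, norm_eq_one_conj_mul hθ, Complex.real_smul]
    push_cast
    ring
  obtain ⟨w, hw, hw'⟩ := sesq_smul_mem s K (1 + r)⁻¹ (by positivity)
    ⟨_, K.add_mem hx (K.smul_mem θ hy), hz⟩
  exact ⟨w, hw, by rw [hw', inv_smul_smul₀ (by positivity)]⟩

/-- Once the cross terms are `r * a`, the value at `x + tθ • y` is `(1 + t r - t²) a`, and this real
quadratic has a root. -/
theorem exists_isotropic_of_opposite (K : Submodule ℂ E) {a : ℂ} (ha0 : a ≠ 0)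
    (ha : ∃ x ∈ K, s x x = a) (hb : ∃ x ∈ K, s x x = -a) : ∃ x ∈ K, x ≠ 0 ∧ s x x = 0 := by
  obtain ⟨x, hx, hxa⟩ := ha
  obtain ⟨y, hy, hya⟩ := hb
  obtain ⟨θ, r, hθ, hr, h⟩ := exists_phase (s x y) (s y x) a ha0
  obtain ⟨t, ht⟩ : ∃ t : ℝ, 1 + t * r - t ^ 2 = 0 := by
    refine ⟨(r + √(r ^ 2 + 4)) / 2, ?_⟩
    have := Real.sq_sqrt (by positivity : 0 ≤ r ^ 2 + 4)
    linear_combination -this / 4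
  refine ⟨x + ((t : ℂ) * θ) • y, K.add_mem hx (K.smul_mem _ hy), ?_, ?_⟩
  -- Otherwise `x` is a multiple of `y` and `a = -t² a`, which forces `a = 0`.
  · intro h0
    have hxy : x = (-((t : ℂ) * θ)) • y := by
      rw [neg_smul]; exact eq_neg_of_add_eq_zero_left h0
    have h1 : a = -((t ^ 2 : ℝ) : ℂ) * a := by
      conv_lhs => rw [← hxa, hxy]
      simp only [LinearMap.map_smulₛₗ, LinearMap.smul_apply, smul_eq_mul, RingHom.id_apply, hya,
        map_neg, map_mul, Complex.conj_ofReal]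
      push_cast
      linear_combination (-(t : ℂ) ^ 2 * a) * norm_eq_one_conj_mul hθ
    have h2 : ((1 + t ^ 2 : ℝ) : ℂ) * a = 0 := by
      push_cast at h1 ⊢
      linear_combination h1
    have h3 : (1 + t ^ 2 : ℝ) ≠ 0 := by positivity
    exact (mul_ne_zero (by exact_mod_cast h3) ha0) h2
  · rw [sesq_add_smul, hxa, hya]
    simp only [map_mul, Complex.conj_ofReal]
    have ht' : (1 + t * r - t ^ 2 : ℂ) = 0 := by exact_mod_cast ht
    linear_combination (t : ℂ) * h + a * ht' - (t : ℂ) ^ 2 * a * norm_eq_one_conj_mul hθ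

/-- If the values of a quadratic form on a subspace contain the terms of a nontrivial series with
sum zero, then the form has an isotropic vector in the subspace. -/
theorem exists_isotropic_of_hasSum_zero {ι : Type*} (K : Submodule ℂ E) {z : ι → ℂ}
    (hz : ∀ i, ∃ x ∈ K, s x x = z i) (hs : HasSum z 0) {j : ι} (hj : z j ≠ 0) :
    ∃ x ∈ K, x ≠ 0 ∧ s x x = 0 := by
  obtain ⟨a, ha, ha0, hb⟩ := exists_neg_mem_of_hasSum_zero (C := {a | ∃ x ∈ K, s x x = a})
    ⟨0, K.zero_mem, by simp⟩ (fun a ha b hb => sesq_add_mem s K ha hb)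
    (fun r hr a ha => sesq_smul_mem s K r hr ha) hz hs hj
  exact exists_isotropic_of_opposite s K ha0 ha hb

end Form

/-! ### A basis with zero diagonal. -/

/-- A sesquilinear form with trace zero in every Hilbert basis has zero diagonal in some Hilbert
basis. -/
theorem exists_hilbertBasis_zero_diagonal {E : Type*} [NormedAddCommGroup E]
    [InnerProductSpace ℂ E] [CompleteSpace E] (s : E →ₗ⋆[ℂ] E →ₗ[ℂ] ℂ)
    (hs : ∀ (w : Set E) (b : HilbertBasis w ℂ E), ⇑b = ((↑) : w → E) →
      HasSum (fun e : w => s (e : E) (e : E)) 0) :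
    ∃ (w : Set E) (b : HilbertBasis w ℂ E), ⇑b = ((↑) : w → E) ∧ ∀ e ∈ w, s e e = 0 := by
  classical
  obtain ⟨S, hS⟩ := zorn_subset
    {A : Set E | Orthonormal ℂ (Subtype.val : A → E) ∧ ∀ e ∈ A, s e e = 0} (fun c hc cc =>
      ⟨⋃₀ c, ⟨orthonormal_sUnion_of_directed cc.directedOn fun x xc => (hc xc).1,
        fun e ⟨A, hA, he⟩ => (hc hA).2 e he⟩, fun _ => Set.subset_sUnion_of_mem⟩)
  obtain ⟨w, b, hSw, hb⟩ := hS.prop.1.exists_hilbertBasis_extension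
  have hw : Orthonormal ℂ (Subtype.val : w → E) := hb ▸ b.orthonormal
  rw [orthonormal_subtype_iff_ite] at hw
  have hnone : ∀ x ∈ (Submodule.span ℂ S)ᗮ, x ≠ 0 → s x x ≠ 0 := by
    intro x hx hx0 hsx
    have hn : ‖x‖ ≠ 0 := norm_ne_zero_iff.2 hx0
    set v : E := ((‖x‖⁻¹ : ℝ) : ℂ) • x with hv
    have hvn : ‖v‖ = 1 := by
      rw [hv, norm_smul, Complex.norm_real, norm_inv, norm_norm, inv_mul_cancel₀ hn]
    have hvx : v ∈ (Submodule.span ℂ S)ᗮ := Submodule.smul_mem _ _ hx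
    have hvS : ∀ e ∈ S, inner ℂ e v = 0 := fun e he =>
      (Submodule.mem_orthogonal _ _).1 hvx e (Submodule.subset_span he)
    have hvS' : ∀ e ∈ S, inner ℂ v e = 0 := fun e he => inner_eq_zero_symm.1 (hvS e he)
    have hvv : inner ℂ v v = 1 := by rw [inner_self_eq_norm_sq_to_K, hvn]; simp
    have hv_notMem : v ∉ S := fun h => one_ne_zero (hvv.symm.trans (hvS v h))
    have hins : insert v S ∈
        {A : Set E | Orthonormal ℂ (Subtype.val : A → E) ∧ ∀ e ∈ A, s e e = 0} := by
      refine ⟨?_, ?_⟩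
      · have hSo := hS.prop.1
        rw [orthonormal_subtype_iff_ite] at hSo ⊢
        rintro p (rfl | hp) q (rfl | hq)
        · rw [hvv, if_pos rfl]
        · rw [hvS' q hq, if_neg]; rintro rfl; exact hv_notMem hq
        · rw [hvS p hp, if_neg]; rintro rfl; exact hv_notMem hp
        · exact hSo p hp q hq
      · rintro p (rfl | hp)
        · rw [hv, sesq_real_smul, hsx, smul_zero]
        · exact hS.prop.2 p hp
    exact hv_notMem (hS.le_of_ge hins (Set.subset_insert v S) (Set.mem_insert v S))
  refine ⟨w, b, hb, fun e he => ?_⟩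
  by_contra hne
  -- Basis vectors outside `S` lie in `Sᗮ`; those in `S` have value 0, which the zero vector
  -- attains.
  have hz : ∀ d : w, ∃ x ∈ (Submodule.span ℂ S)ᗮ, s x x = s (d : E) (d : E) := by
    intro d
    by_cases hd : (d : E) ∈ S
    · exact ⟨0, Submodule.zero_mem _, by simp [hS.prop.2 d hd]⟩
    · refine ⟨d, ?_, rfl⟩
      rw [Submodule.mem_orthogonal]
      intro u hu
      induction hu using Submodule.span_induction with
      | mem p hp =>
        rw [hw p (hSw hp) d d.2, if_neg]
        rintro rfl
        exact hd hp
      | zero => simp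
      | add p q _ _ hp hq => rw [inner_add_left, hp, hq, add_zero]
      | smul c p _ hp => rw [inner_smul_left, hp, mul_zero]
  obtain ⟨x, hx, hx0, hsx⟩ :=
    exists_isotropic_of_hasSum_zero s _ hz (hs w b hb) (j := ⟨e, he⟩) hne
  exact hnone x hx hx0 hsx

/-! ### Conditional states and bases of the first factor. -/

section TensorBasis

variable {HA HB : Type*}
  [NormedAddCommGroup HA] [InnerProductSpace ℂ HA]
  [NormedAddCommGroup HB] [InnerProductSpace ℂ HB]

theorem HilbertTensor.clm_ext {X : Type*} [NormedAddCommGroup X] [NormedSpace ℂ X]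
    {f g : HilbertTensor HA HB →L[ℂ] X}
    (h : ∀ v w, f (productVector v w) = g (productVector v w)) : f = g := by
  ext x
  induction x using UniformSpace.Completion.induction_on with
  | hp => exact isClosed_eq f.continuous g.continuous
  | ih t =>
    induction t using TensorProduct.induction_on with
    | zero => rw [UniformSpace.Completion.coe_zero, map_zero, map_zero]
    | tmul v w => exact h v w
    | add a b ha hb => rw [UniformSpace.Completion.coe_add, map_add, map_add, ha, hb]

theorem inner_productVector (v v' : HA) (w w' : HB) :
    inner ℂ (productVector v w) (productVector v' w') = inner ℂ v v' * inner ℂ w w' := by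
  rw [productVector, productVector, UniformSpace.Completion.inner_coe, TensorProduct.inner_tmul]

/-- The vector `|v⟩ ⊗ |w⟩` as a bounded bilinear function. -/
noncomputable def productVectorL : HA →L[ℂ] HB →L[ℂ] HilbertTensor HA HB :=
  (ContinuousLinearMap.compL ℂ HB (HA ⊗[ℂ] HB) (HilbertTensor HA HB)
    UniformSpace.Completion.toComplL) ∘L TensorProduct.mkL ℂ HA HB

theorem productVectorL_apply (v : HA) (w : HB) : productVectorL v w = productVector v w := rfl

/-- The embedding `w ↦ |v⟩ ⊗ |w⟩` for a unit vector `v`. -/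
noncomputable def productVectorIsometry (v : HA) (hv : ‖v‖ = 1) :
    HB →ₗᵢ[ℂ] HilbertTensor HA HB where
  toLinearMap := (productVectorL v : HB →L[ℂ] HilbertTensor HA HB).toLinearMap
  norm_map' w := by
    change ‖productVector v w‖ = ‖w‖
    rw [productVector, UniformSpace.Completion.norm_coe, TensorProduct.norm_tmul, hv, one_mul]

theorem productVectorIsometry_apply (v : HA) (hv : ‖v‖ = 1) (w : HB) :
    productVectorIsometry v hv w = productVector v w := rfl

theorem operatorTensor_zero_right (E : HA →L[ℂ] HA) :
    operatorTensor E (0 : HB →L[ℂ] HB) = 0 :=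
  HilbertTensor.clm_ext fun v w => by
    rw [operatorTensor_productVector]
    simp [productVector]

variable [CompleteSpace HB]

theorem partialBra_productVector (a v : HA) (w : HB) :
    partialBra a (productVector v w) = inner ℂ a v • w := condState_productVector v w a

theorem condState_add_right (τ : HilbertTensor HA HB) (a b : HA) :
    condState τ (a + b) = condState τ a + condState τ b := by
  have : (partialBra (a + b) : HilbertTensor HA HB →L[ℂ] HB) = partialBra a + partialBra b :=
    HilbertTensor.clm_ext fun v w => by
      simp only [_root_.add_apply, partialBra_productVector, inner_add_left, add_smul]
  simp only [condState, this, _root_.add_apply]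

theorem condState_smul_right (τ : HilbertTensor HA HB) (c : ℂ) (a : HA) :
    condState τ (c • a) = starRingEnd ℂ c • condState τ a := by
  have : (partialBra (c • a) : HilbertTensor HA HB →L[ℂ] HB) =
      starRingEnd ℂ c • partialBra a :=
    HilbertTensor.clm_ext fun v w => by
      simp only [_root_.smul_apply, partialBra_productVector, inner_smul_left,
        mul_smul]
  simp only [condState, this, _root_.smul_apply]

theorem inner_productVector_left (a : HA) (w : HB) (x : HilbertTensor HA HB) :
    inner ℂ (productVector a w) x = inner ℂ w (condState x a) := by
  have : innerSL ℂ (productVector a w) = innerSL ℂ w ∘L partialBra a :=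
    HilbertTensor.clm_ext fun v u => by
      simp only [innerSL_apply_apply, ContinuousLinearMap.comp_apply, partialBra_productVector,
        inner_productVector, inner_smul_right]
  exact DFunLike.congr_fun this x

theorem inner_productVector_right (a : HA) (w : HB) (x : HilbertTensor HA HB) :
    inner ℂ x (productVector a w) = inner ℂ (condState x a) w := by
  rw [← inner_conj_symm, inner_productVector_left, inner_conj_symm]

theorem operatorTensor_rankOne_apply (e : HA) (F : HB →L[ℂ] HB) (x : HilbertTensor HA HB) :
    operatorTensor (InnerProductSpace.rankOne ℂ e e) F x = productVector e (F (condState x e)) := by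
  have : operatorTensor (InnerProductSpace.rankOne ℂ e e) F =
      productVectorL e ∘L F ∘L partialBra e :=
    HilbertTensor.clm_ext fun v w => by
      rw [operatorTensor_productVector, InnerProductSpace.rankOne_apply]
      simp only [ContinuousLinearMap.comp_apply, partialBra_productVector, map_smul]
      rw [← productVectorL_apply, map_smul, _root_.smul_apply]
  rw [this]
  rfl

theorem inner_operatorTensor_rankOne (e : HA) (F : HB →L[ℂ] HB) (x y : HilbertTensor HA HB) :
    inner ℂ y (operatorTensor (InnerProductSpace.rankOne ℂ e e) F x) =
      inner ℂ (condState y e) (F (condState x e)) := by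
  rw [operatorTensor_rankOne_apply, inner_productVector_right]

variable {ι : Type*} (b : HilbertBasis ι ℂ HA)

/-- Totality: a vector orthogonal to every `b i ⊗ w` is orthogonal to all product vectors, by
expanding the first factor in `b`, hence is zero. -/
theorem HilbertBasis.isHilbertSum_productVectorIsometry :
    IsHilbertSum ℂ (fun _ : ι => HB)
      (fun i => productVectorIsometry (HB := HB) (b i) (b.orthonormal.1 i)) := by
  refine IsHilbertSum.mk ?_ ?_
  · intro i j hij v w
    rw [productVectorIsometry_apply, productVectorIsometry_apply, inner_productVector,
      b.orthonormal.2 hij, zero_mul]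
  · rw [top_le_iff, Submodule.topologicalClosure_eq_top_iff, Submodule.eq_bot_iff]
    intro x hx
    have h1 : ∀ i w, inner ℂ x (productVector (b i) w) = 0 := fun i w =>
      inner_eq_zero_symm.1 ((Submodule.mem_orthogonal _ _).1 hx _
        (Submodule.mem_iSup_of_mem i ⟨w, rfl⟩))
    have h2 : innerSL ℂ x = 0 := HilbertTensor.clm_ext fun v w => by
      have hs := ((innerSL ℂ x) ∘L productVectorL.flip w).hasSum (b.hasSum_repr v)
      have h0 : ∀ i, ((innerSL ℂ x) ∘L productVectorL.flip w) (b.repr v i • b i) = 0 := by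
        intro i
        rw [map_smul]
        simp only [ContinuousLinearMap.comp_apply, ContinuousLinearMap.flip_apply,
          productVectorL_apply, innerSL_apply_apply, h1, smul_zero]
      simp only [h0] at hs
      exact hs.unique hasSum_zero
    exact inner_self_eq_zero.1 (DFunLike.congr_fun h2 x : inner ℂ x x = 0)

/-- The projections `|b i⟩⟨b i| ⊗ 1` resolve the identity. -/
theorem HilbertBasis.hasSum_productVector_condState (x : HilbertTensor HA HB) :
    HasSum (fun i => productVector (b i) (condState x (b i))) x := by
  have hV := b.isHilbertSum_productVectorIsometry (HB := HB)
  obtain ⟨w, rfl⟩ := hV.linearIsometryEquiv.symm.surjective x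
  have hs := hV.hasSum_linearIsometryEquiv_symm w
  have hc : ∀ j, condState (hV.linearIsometryEquiv.symm w) (b j) = w j := by
    classical
    intro j
    have h1 := (partialBra (HB := HB) (b j)).hasSum hs
    refine h1.unique ?_
    have h2 : ∀ i, partialBra (b j) (productVectorIsometry (b i) (b.orthonormal.1 i) (w i)) =
        inner ℂ (b j) (b i) • w i := fun i => partialBra_productVector _ _ _
    simp only [h2]
    have h3 := hasSum_single (f := fun i => inner ℂ (b j) (b i) • w i) j fun i hij => by
      rw [b.orthonormal.2 hij.symm, zero_smul]
    simpa only [inner_self_eq_norm_sq_to_K, b.orthonormal.1 j, RCLike.ofReal_one, one_pow,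
      one_smul] using h3
  simpa only [hc, productVectorIsometry_apply] using hs

/-- The trace formula `∑ i, ⟨y^{|i}|x^{|i}⟩ = ⟨y|x⟩`. -/
theorem HilbertBasis.hasSum_inner_condState (x y : HilbertTensor HA HB) :
    HasSum (fun i => inner ℂ (condState y (b i)) (condState x (b i))) (inner ℂ y x) := by
  simpa only [innerSL_apply_apply, inner_productVector_right] using
    (innerSL ℂ y).hasSum (b.hasSum_productVector_condState x)

theorem HilbertBasis.hasSum_norm_sq_condState (x : HilbertTensor HA HB) :
    HasSum (fun i => ‖condState x (b i)‖ ^ 2) (‖x‖ ^ 2) := by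
  have h := Complex.hasSum_re (b.hasSum_inner_condState x x)
  have hre : ∀ v : HB, (inner ℂ v v).re = ‖v‖ ^ 2 := fun v => inner_self_eq_norm_sq (𝕜 := ℂ) v
  have hre' : (inner ℂ x x).re = ‖x‖ ^ 2 := inner_self_eq_norm_sq (𝕜 := ℂ) x
  simpa only [hre, hre'] using h

/-- Two orthogonal vectors have orthogonal conditional states in some Hilbert basis. -/
theorem exists_hilbertBasis_inner_condState_eq_zero [CompleteSpace HA]
    {ψ φ : HilbertTensor HA HB} (h : inner ℂ φ ψ = 0) :
    ∃ (w : Set HA) (b : HilbertBasis w ℂ HA), ⇑b = ((↑) : w → HA) ∧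
      ∀ e ∈ w, inner ℂ (condState φ e) (condState ψ e) = 0 := by
  refine exists_hilbertBasis_zero_diagonal
    -- `condState` is antilinear in the outcome vector, so the slot of `ψ` is the conjugate-linear
    -- one.
    (LinearMap.mk₂'ₛₗ (starRingEnd ℂ) (RingHom.id ℂ)
      (fun a c => inner ℂ (condState φ c) (condState ψ a)) ?_ ?_ ?_ ?_) fun w b hb => ?_
  · intro a a' c; rw [condState_add_right, inner_add_right]
  · intro r a c; rw [condState_smul_right, inner_smul_right, smul_eq_mul]
  · intro a c c'; rw [condState_add_right, inner_add_left]
  · intro r a c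
    rw [condState_smul_right, inner_smul_left, Complex.conj_conj, RingHom.id_apply, smul_eq_mul]
  · have := b.hasSum_inner_condState ψ φ
    rw [h, hb] at this
    exact this

end TensorBasis

/-! ### Effects, probabilities and messages. -/

section Protocol

variable {HA HB : Type*}
  [NormedAddCommGroup HA] [InnerProductSpace ℂ HA]
  [NormedAddCommGroup HB] [InnerProductSpace ℂ HB] [CompleteSpace HB]

theorem isPositive_operatorTensor_rankOne (e : HA) {F : HB →L[ℂ] HB} (hF : F.IsPositive) :
    (operatorTensor (InnerProductSpace.rankOne ℂ e e) F).IsPositive := by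
  have hsymm : ∀ x y : HilbertTensor HA HB,
      inner ℂ (operatorTensor (InnerProductSpace.rankOne ℂ e e) F x) y =
        inner ℂ (F (condState x e)) (condState y e) := fun x y => by
    rw [← inner_conj_symm, inner_operatorTensor_rankOne, inner_conj_symm]
  refine ⟨fun x y => ?_, fun x => ?_⟩
  · refine (hsymm x y).trans ?_
    refine Eq.trans ?_ (inner_operatorTensor_rankOne e F y x).symm
    exact hF.isSymmetric _ _
  · rw [ContinuousLinearMap.reApplyInnerSelf_apply, hsymm]
    exact hF.re_inner_nonneg_left _

theorem bornProb_sum_operatorTensor_rankOne {ι : Type*} (G : Finset ι) (e : ι → HA)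
    (F : ι → HB →L[ℂ] HB) (x : HilbertTensor HA HB) :
    bornProb (∑ i ∈ G, operatorTensor (InnerProductSpace.rankOne ℂ (e i) (e i)) (F i)) x =
      ∑ i ∈ G, (inner ℂ (condState x (e i)) (F i (condState x (e i)))).re := by
  rw [bornProb, _root_.sum_apply, inner_sum, Complex.re_sum]
  simp only [inner_operatorTensor_rankOne]

theorem re_inner_self_eq_norm_sq {X : Type*} [NormedAddCommGroup X] [InnerProductSpace ℂ X]
    (v : X) : (inner ℂ v v).re = ‖v‖ ^ 2 := inner_self_eq_norm_sq (𝕜 := ℂ) v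

theorem bornProb_one_sub {X : Type*} [NormedAddCommGroup X] [InnerProductSpace ℂ X]
    (M : X →L[ℂ] X) (x : X) : bornProb (1 - M) x = ‖x‖ ^ 2 - bornProb M x := by
  rw [bornProb, bornProb, ← re_inner_self_eq_norm_sq, ← Complex.sub_re, ← inner_sub_right]
  rfl

/-- The expectation of the sum in `x` is at most `∑ i ∈ G, ‖x^{|i}‖²`, which is at most `‖x‖²`. -/
theorem isPositive_one_sub_sum_operatorTensor_rankOne {ι : Type*} (b : HilbertBasis ι ℂ HA)
    (G : Finset ι) {F : ι → HB →L[ℂ] HB} (hF : ∀ i, (F i).IsPositive)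
    (hF1 : ∀ i, (1 - F i).IsPositive) :
    (1 - ∑ i ∈ G, operatorTensor (InnerProductSpace.rankOne ℂ (b i) (b i)) (F i)).IsPositive := by
  set M := ∑ i ∈ G, operatorTensor (InnerProductSpace.rankOne ℂ (b i) (b i)) (F i) with hM
  have hMpos : M.IsPositive := ContinuousLinearMap.isPositive_sum G fun i _ =>
    isPositive_operatorTensor_rankOne (b i) (hF i)
  have hsymm : (1 - M : HilbertTensor HA HB →L[ℂ] HilbertTensor HA HB).IsSymmetric :=
    ContinuousLinearMap.isPositive_one.isSymmetric.sub hMpos.isSymmetric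
  refine ⟨hsymm, fun x => ?_⟩
  have hx : (1 - M).reApplyInnerSelf x = bornProb (1 - M) x := by
    rw [ContinuousLinearMap.reApplyInnerSelf_apply]
    exact congrArg Complex.re (hsymm x x)
  rw [hx, bornProb_one_sub, hM, bornProb_sum_operatorTensor_rankOne, sub_nonneg]
  refine le_trans (Finset.sum_le_sum fun i _ => ?_)
    (sum_le_hasSum G (fun i _ => sq_nonneg _) (b.hasSum_norm_sq_condState x))
  have h := (hF1 i).re_inner_nonneg_right (condState x (b i))
  have h' : 0 ≤ bornProb (1 - F i) (condState x (b i)) := h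
  rw [bornProb_one_sub, sub_nonneg] at h'
  exact h'

/-- Elements of a nonempty finite set have distinct labels of `⌈log₂ |G|⌉ + 1` bits which all
differ from one further label, given to the elements outside the set. -/
theorem exists_message {ι : Type*} (G : Finset ι) :
    ∃ (message : ι → Fin (Nat.clog 2 G.card + 1) → Bool)
      (flag : Fin (Nat.clog 2 G.card + 1) → Bool),
      Set.InjOn message G ∧ (∀ e ∈ G, message e ≠ flag) ∧ ∀ e ∉ G, message e = flag := by
  classical
  have hcard : Fintype.card G ≤ Fintype.card (Fin (Nat.clog 2 G.card) → Bool) := by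
    simpa using Nat.le_pow_clog one_lt_two G.card
  obtain ⟨f⟩ := Function.Embedding.nonempty_of_card_le hcard
  -- The extra leading bit records membership in `G`.
  refine ⟨fun e => if h : e ∈ G then Fin.cons true (f ⟨e, h⟩) else fun _ => false,
    fun _ => false, fun e he e' he' h => ?_, fun e he h => ?_, fun e he => dif_neg he⟩
  · rw [Finset.mem_coe] at he he'
    simp only [dif_pos he, dif_pos he'] at h
    exact congrArg Subtype.val (f.injective (Fin.cons_injective2 h).2)
  · simp only [dif_pos he] at h
    simpa using congrFun h 0

/-- Bob's decoder: it turns a message into the vector he projects onto. -/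
theorem exists_left_inverse_on {ι α X : Type*} [Zero X] {G : Finset ι} {m : ι → α}
    (hm : Set.InjOn m G) {flag : α} (hflag : ∀ e ∈ G, m e ≠ flag) (u : ι → X) :
    ∃ v : α → X, (∀ e ∈ G, v (m e) = u e) ∧ v flag = 0 := by
  classical
  refine ⟨fun a => if h : ∃ e ∈ G, m e = a then u h.choose else 0, fun e he => ?_, ?_⟩
  · have h : ∃ e' ∈ G, m e' = m e := ⟨e, he, rfl⟩
    exact (dif_pos h).trans (congrArg u (hm h.choose_spec.1 he h.choose_spec.2))
  · refine dif_neg ?_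
    rintro ⟨e, he, h⟩
    exact hflag e he h

end Protocol

/-! ### Construction of the protocol. -/

theorem corollary1 {HA HB : Type*}
    [NormedAddCommGroup HA] [InnerProductSpace ℂ HA] [CompleteSpace HA]
    [NormedAddCommGroup HB] [InnerProductSpace ℂ HB] [CompleteSpace HB]
    (ψ φ : HilbertTensor HA HB) (hψ : ‖ψ‖ = 1) (hφ : ‖φ‖ = 1) (hψφ : inner ℂ ψ φ = 0)
    (ε : ℝ) (hε : 0 < ε) :
    -- an orthonormal basis `𝓔` of `HA`, a nonempty finite part `G` of it, and a one-way LOCC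
    -- protocol with `n` bits of communication
    ∃ (𝓔 : Set HA) (b : HilbertBasis 𝓔 ℂ HA) (G : Finset 𝓔) (n : ℕ)
      (P : OneWayLOCC HA HB 𝓔 n)
      (M : HilbertTensor HA HB →L[ℂ] HilbertTensor HA HB),
      -- the protocol succeeds with probability at least `1 - ε` on each of the two states
      P.HasOperator M ∧ M.IsPositive ∧ (1 - M).IsPositive ∧
      1 - ε ≤ bornProb M ψ ∧ 1 - ε ≤ bornProb (1 - M) φ ∧
      -- Alice measures in the basis `𝓔`, for which all conditional states are orthogonal
      (∀ e, b e = (e : HA)) ∧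
      (∀ e, P.E e = InnerProductSpace.rankOne ℂ (e : HA) (e : HA)) ∧
      (∀ e : 𝓔, inner ℂ (condState φ (e : HA)) (condState ψ (e : HA)) = 0) ∧
      -- the outcomes in `G` have probability at least `1 - ε` under both states
      G.Nonempty ∧
      1 - ε ≤ bornProb (∑ e ∈ G, operatorTensor (P.E e) (1 : HB →L[ℂ] HB)) ψ ∧
      1 - ε ≤ bornProb (∑ e ∈ G, operatorTensor (P.E e) (1 : HB →L[ℂ] HB)) φ ∧
      -- the message specifies the outcome if it is in `G`, and is one fixed other string if not
      Set.InjOn P.message (G : Set 𝓔) ∧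
      (∃ flag : Fin n → Bool,
        (∀ e ∈ G, P.message e ≠ flag) ∧ ∀ e ∉ G, P.message e = flag) ∧
      n ≤ Nat.clog 2 G.card + 1 ∧
      -- on the outcomes in `G`, Bob discriminates the conditional states perfectly
      (∀ e ∈ G, P.F (P.message e) (condState ψ (e : HA)) = condState ψ (e : HA) ∧
        P.F (P.message e) (condState φ (e : HA)) = 0) := by
  classical
  obtain ⟨𝓔, b, hb, horth⟩ := exists_hilbertBasis_inner_condState_eq_zero
    (inner_eq_zero_symm.1 hψφ)
  have hbe : ∀ e : 𝓔, b e = (e : HA) := fun e => congrFun hb e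
  have hconv : ∀ τ : HilbertTensor HA HB, ‖τ‖ = 1 → ∀ᶠ G : Finset 𝓔 in Filter.atTop,
      1 - ε ≤ ∑ e ∈ G, ‖condState τ (e : HA)‖ ^ 2 := by
    intro τ hτ
    have h : Filter.Tendsto (fun G : Finset 𝓔 => ∑ e ∈ G, ‖condState τ (b e)‖ ^ 2)
        Filter.atTop (nhds (‖τ‖ ^ 2)) := b.hasSum_norm_sq_condState τ
    simp only [hbe, hτ, one_pow] at h
    exact h.eventually_const_le (by linarith)
  -- For `ε ≥ 1` the empty set meets both bounds, so an element is forced into `G`.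
  obtain ⟨e₀⟩ : Nonempty 𝓔 := by
    by_contra hempty
    rw [not_nonempty_iff] at hempty
    have h := (b.hasSum_norm_sq_condState ψ).unique hasSum_empty
    rw [hψ] at h
    norm_num at h
  obtain ⟨G, ⟨hGψ, hGφ⟩, hG₀⟩ :=
    (((hconv ψ hψ).and (hconv φ hφ)).and (Filter.eventually_ge_atTop {e₀})).exists
  obtain ⟨message, flag, hinj, hflag, hout⟩ := exists_message G
  obtain ⟨v, hv, hv0⟩ := exists_left_inverse_on hinj hflag fun e => condState ψ (e : HA)
  set F : (Fin (Nat.clog 2 G.card + 1) → Bool) → HB →L[ℂ] HB :=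
    fun m => (ℂ ∙ v m).starProjection with hF
  have hFproj : ∀ m, IsStarProjection (F m) := fun m => isStarProjection_starProjection
  have hFψ : ∀ e ∈ G, F (message e) (condState ψ (e : HA)) = condState ψ (e : HA) := by
    intro e he
    rw [hF]
    simp only [hv e he]
    exact Submodule.starProjection_eq_self_iff.2 (Submodule.mem_span_singleton_self _)
  have hFφ : ∀ e ∈ G, F (message e) (condState φ (e : HA)) = 0 := by
    intro e he
    rw [hF]
    simp only [hv e he]
    exact (Submodule.starProjection_apply_eq_zero_iff _).2
      (Submodule.mem_orthogonal_singleton_iff_inner_left.2 (horth e e.2))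
  -- The flag decodes to the zero vector, whose span is trivial; hence the operator of the protocol
  -- is a finite sum over `G`.
  have hFflag : F flag = 0 := by
    ext x
    simp [hF, hv0]
  let P : OneWayLOCC HA HB 𝓔 (Nat.clog 2 G.card + 1) :=
    { E := fun e => InnerProductSpace.rankOne ℂ (e : HA) (e : HA)
      E_pos := fun e => InnerProductSpace.isPositive_rankOne_self _
      E_sum := fun x => by
        simpa only [b.repr_apply_apply, hbe, InnerProductSpace.rankOne_apply] using b.hasSum_repr x
      message := message
      F := F
      F_pos := fun m => .of_isStarProjection (hFproj m)
      F_le_one := fun m => .of_isStarProjection (hFproj m).one_sub }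
  set M : HilbertTensor HA HB →L[ℂ] HilbertTensor HA HB :=
    ∑ e ∈ G, operatorTensor (InnerProductSpace.rankOne ℂ (e : HA) (e : HA)) (F (message e)) with hM
  have hMψ : bornProb M ψ = ∑ e ∈ G, ‖condState ψ (e : HA)‖ ^ 2 := by
    rw [hM, bornProb_sum_operatorTensor_rankOne]
    exact Finset.sum_congr rfl fun e he => by rw [hFψ e he, re_inner_self_eq_norm_sq]
  -- The state `φ` is identified with certainty; only `ψ` can be misjudged.
  have hMφ : bornProb M φ = 0 := by
    rw [hM, bornProb_sum_operatorTensor_rankOne]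
    exact Finset.sum_eq_zero fun e he => by rw [hFφ e he, inner_zero_right, Complex.zero_re]
  have hGprob : ∀ τ : HilbertTensor HA HB,
      bornProb (∑ e ∈ G, operatorTensor (P.E e) (1 : HB →L[ℂ] HB)) τ =
        ∑ e ∈ G, ‖condState τ (e : HA)‖ ^ 2 := fun τ =>
    (bornProb_sum_operatorTensor_rankOne G _ _ τ).trans
      (Finset.sum_congr rfl fun e _ => re_inner_self_eq_norm_sq _)
  refine ⟨𝓔, b, G, _, P, M, fun x => ?_, ?_, ?_, hMψ ▸ hGψ, ?_, hbe, fun e => rfl,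
    fun e => horth e e.2, ⟨e₀, hG₀ (Finset.mem_singleton_self e₀)⟩, (hGprob ψ).symm ▸ hGψ,
    (hGprob φ).symm ▸ hGφ, hinj, ⟨flag, hflag, hout⟩, le_rfl,
    fun e he => ⟨hFψ e he, hFφ e he⟩⟩
  · rw [hM, _root_.sum_apply]
    refine hasSum_sum_of_ne_finset_zero fun e he => ?_
    change operatorTensor _ (F (message e)) x = 0
    rw [hout e he, hFflag, operatorTensor_zero_right, _root_.zero_apply]
  · exact ContinuousLinearMap.isPositive_sum G fun e _ =>
      isPositive_operatorTensor_rankOne _ (.of_isStarProjection (hFproj _))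
  · have h := isPositive_one_sub_sum_operatorTensor_rankOne b G (F := fun e => F (message e))
      (fun e => .of_isStarProjection (hFproj _)) fun e => .of_isStarProjection (hFproj _).one_sub
    simpa only [hbe] using h
  · rw [bornProb_one_sub, hMφ, hφ]
    linarith
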